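/- Let $k$ be a commutative ring, let $V$ be the category of $k$-modules, and let $C$ be a small $k$-linear category (a category enriched in $V$) with all finite colimits. Let $[C^{\mathrm{op}},V]$ be the category of $k$-linear functors $C^{\mathrm{op}}\to V$ and natural transformations, and let $\operatorname{Lex}[C^{\mathrm{op}},V]$ be its full subcategory of left exact functors, i.e. those that preserve finite limits. Then the inclusion $\operatorname{Lex}[C^{\mathrm{op}},V]\hookrightarrow[C^{\mathrm{op}},V]$ has a left adjoint, and for any left adjoint $L:[C^{\mathrm{op}},V]\to\operatorname{Lex}[C^{\mathrm{op}},V]$ of it the following holds: the category $\operatorname{Lex}[C^{\mathrm{op}},V]$ is abelian if and only if $L$ is left exact (preserves finite limits). -/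

import Mathlib

open CategoryTheory CategoryTheory.Limits

universe u

section

variable (k : Type u) [CommRing k] (C : Type u) [SmallCategory C] [Preadditive C] [Linear k C]

/-- A functor `F : Cᵒᵖ ⥤ ModuleCat k` is `k`-linear (that is, enriched in `k`-modules): its action
`C(X, Y) → Hom(F Y, F X)` on each hom-module is additive and commutes with scalars. -/
def IsLinearPresheaf : ObjectProperty (Cᵒᵖ ⥤ ModuleCat.{u} k) := fun F =>
  F.Additive ∧ ∀ (X Y : C) (r : k) (f : X ⟶ Y), F.map (r • f).op = r • F.map f.op

/-- The category `[Cᵒᵖ, V]`, with `V` the category of `k`-modules: `k`-linear functors `Cᵒᵖ ⥤ V`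
and all natural transformations between them. -/
abbrev LinearPresheaf := (IsLinearPresheaf k C).FullSubcategory

/-- A `k`-linear functor `Cᵒᵖ ⥤ ModuleCat k` that is left exact: it preserves finite limits, i.e.
it sends finite colimits of `C` to finite limits of `k`-modules. -/
def IsLexPresheaf : ObjectProperty (Cᵒᵖ ⥤ ModuleCat.{u} k) := fun F =>
  IsLinearPresheaf k C F ∧ PreservesFiniteLimits F

/-- The category `Lex[Cᵒᵖ, V]`: left exact `k`-linear functors `Cᵒᵖ ⥤ V` and all natural
transformations between them. -/
abbrev LexPresheaf := (IsLexPresheaf k C).FullSubcategory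

/-- The full inclusion `Lex[Cᵒᵖ, V] ⥤ [Cᵒᵖ, V]`. -/
abbrev lexInclusion : LexPresheaf k C ⥤ LinearPresheaf k C :=
  ObjectProperty.ιOfLE (fun _ h => h.1)

end

/-! ### Linear presheaves: closure properties and the Yoneda lemma. -/

section
variable (k : Type u) [CommRing k] (C : Type u) [SmallCategory C] [Preadditive C] [Linear k C]

/-! A linear presheaf is left exact iff it turns cokernels of `C` into kernels, i.e. iff it is local
for the small set of comparisons from the cokernel of `yonedaMap k f` to the presheaf represented by
`cokernel f`. Their ends are finitely presentable, so the local objects are reflective.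

If `L` is left exact, `Lex` inherits abelianness from the ambient category. Conversely let `Lex` be
abelian; `L` is right exact, so it need only preserve monomorphisms. A map between representables
lies in `Lex`, and `L` keeps the inclusion of its image monic
(`mono_map_of_epi_mono_factorisation`). Filtered colimits in `Lex` are pointwise, which extends this
to all subobjects of representables; a pullback handles subobjects of their quotients
(`mono_map_of_epi`); and every presheaf is the directed union of its cyclic subpresheaves, which
gives the general case (`mono_map`). -/

instance isLinearPresheaf_isClosedUnderColimitsOfShape {J : Type*} [Category* J]
    [HasColimitsOfShape J (ModuleCat.{u} k)] :
    (IsLinearPresheaf k C).IsClosedUnderColimitsOfShape J where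
  colimitsOfShape_le := by
    rintro G ⟨h⟩
    have hom_ext {X Y : Cᵒᵖ} {f g : G.obj X ⟶ G.obj Y}
        (w : ∀ j (α : h.diag.obj j ⟶ G), α.app X ≫ f = α.app X ≫ g) : f = g :=
      (isColimitOfPreserves ((evaluation _ _).obj X) h.isColimit).hom_ext fun j => w j (h.ι.app j)
    refine ⟨⟨fun {X Y f g} => hom_ext fun j α => ?_⟩, fun X Y r f => hom_ext fun j α => ?_⟩
    · have := (h.prop_diag_obj j).1
      simp only [Preadditive.comp_add, ← NatTrans.naturality, Functor.map_add, Preadditive.add_comp]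
    · simp only [Linear.comp_smul, ← NatTrans.naturality, (h.prop_diag_obj j).2, Linear.smul_comp]

instance isLinearPresheaf_isClosedUnderLimitsOfShape {J : Type*} [Category* J]
    [HasLimitsOfShape J (ModuleCat.{u} k)] :
    (IsLinearPresheaf k C).IsClosedUnderLimitsOfShape J where
  limitsOfShape_le := by
    rintro G ⟨h⟩
    have hom_ext {X Y : Cᵒᵖ} {f g : G.obj X ⟶ G.obj Y}
        (w : ∀ j (α : G ⟶ h.diag.obj j), f ≫ α.app Y = g ≫ α.app Y) : f = g :=
      (isLimitOfPreserves ((evaluation _ _).obj Y) h.isLimit).hom_ext fun j => w j (h.π.app j)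
    refine ⟨⟨fun {X Y f g} => hom_ext fun j α => ?_⟩, fun X Y r f => hom_ext fun j α => ?_⟩
    · have := (h.prop_diag_obj j).1
      simp only [Preadditive.add_comp, NatTrans.naturality, Functor.map_add, Preadditive.comp_add]
    · simp only [Linear.smul_comp, NatTrans.naturality, (h.prop_diag_obj j).2, Linear.comp_smul]

instance : (IsLinearPresheaf k C).ContainsZero where
  exists_zero := by
    have h := isZero_zero (Cᵒᵖ ⥤ ModuleCat.{u} k)
    exact ⟨_, h, ⟨⟨((Functor.isZero_iff _).1 h _).eq_of_src _ _⟩,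
      fun _ _ _ _ => ((Functor.isZero_iff _).1 h _).eq_of_src _ _⟩⟩

instance : (IsLinearPresheaf k C).IsClosedUnderKernels where
  kernels_le := by
    rintro _ ⟨f, s, hs, hf⟩
    exact ObjectProperty.prop_of_isLimit _ hs (by rintro (_ | _); exacts [hf.1, hf.2])

instance : (IsLinearPresheaf k C).IsClosedUnderCokernels where
  cokernels_le := by
    rintro _ ⟨f, s, hs, hf⟩
    exact ObjectProperty.prop_of_isColimit _ hs (by rintro (_ | _); exacts [hf.1, hf.2])

instance : (IsLinearPresheaf k C).IsClosedUnderFiniteProducts where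

noncomputable instance : Abelian (LinearPresheaf k C) := inferInstance

instance : HasColimitsOfSize.{u, u} (LinearPresheaf k C) where

/-- Filtered colimits commute with finite limits of modules; hence filtered colimits in `Lex` are
pointwise. -/
instance isLexPresheaf_isClosedUnderColimitsOfShape {J : Type u} [SmallCategory J] [IsFiltered J] :
    (IsLexPresheaf k C).IsClosedUnderColimitsOfShape J where
  colimitsOfShape_le := by
    rintro G ⟨h⟩
    exact ⟨(IsLinearPresheaf k C).prop_of_isColimit h.isColimit fun j => (h.prop_diag_obj j).1,
      (ObjectProperty.preservesFiniteLimits).prop_of_isColimit h.isColimit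
        fun j => (h.prop_diag_obj j).2⟩

/-- The representable presheaf `C(-, c)`, as a left exact `k`-linear presheaf. -/
abbrev lexYoneda (c : C) : LexPresheaf k C where
  obj := (linearYoneda k C).obj c
  property := by
    refine ⟨⟨inferInstance, fun X Y r f => ?_⟩, ?_⟩
    · ext g
      exact Linear.smul_comp _ _ _ r f g
    · have : PreservesFiniteLimits ((linearYoneda k C).obj c ⋙ forget (ModuleCat.{u} k)) :=
        inferInstanceAs (PreservesFiniteLimits (yoneda.obj c))
      exact preservesFiniteLimits_of_reflects_of_preserves _ (forget (ModuleCat.{u} k))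

variable {k C}

/-- The morphism out of a representable presheaf determined by an element. -/
def LinearPresheaf.ofElement {F : LinearPresheaf k C} {c : C} (x : F.obj.obj (Opposite.op c)) :
    (lexInclusion k C).obj (lexYoneda k C c) ⟶ F :=
  ObjectProperty.homMk
    { app X := ModuleCat.ofHom
        { toFun f := F.obj.map (Quiver.Hom.op f) x
          map_add' f g := by
            have := F.property.1
            change F.obj.map (Quiver.Hom.op f + Quiver.Hom.op g) x = _
            rw [Functor.map_add]; rfl
          map_smul' r f := by
            change F.obj.map (Quiver.Hom.op (r • (show X.unop ⟶ c from f))) x = _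
            rw [F.property.2]; rfl }
      naturality X Y f := by
        ext g
        change F.obj.map (Quiver.Hom.op (f.unop ≫ (show X.unop ⟶ c from g))) x = _
        rw [op_comp, Functor.map_comp]; rfl }

lemma LinearPresheaf.ofElement_app {F : LinearPresheaf k C} {c d : C}
    (x : F.obj.obj (Opposite.op c)) (f : d ⟶ c) :
    (ofElement x).hom.app (Opposite.op d) f = F.obj.map f.op x := rfl

lemma LinearPresheaf.ofElement_app_id {F : LinearPresheaf k C} {c : C}
    (x : F.obj.obj (Opposite.op c)) :
    (ofElement x).hom.app (Opposite.op c) (𝟙 c) = x := by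
  rw [ofElement_app, op_id, F.obj.map_id]; rfl

lemma LinearPresheaf.hom_yoneda_ext {F : LinearPresheaf k C} {c : C}
    {f g : (lexInclusion k C).obj (lexYoneda k C c) ⟶ F}
    (h : f.hom.app (Opposite.op c) (𝟙 c) = g.hom.app (Opposite.op c) (𝟙 c)) : f = g := by
  ext d a
  have key (f : (lexInclusion k C).obj (lexYoneda k C c) ⟶ F) :
      f.hom.app d a = F.obj.map (Quiver.Hom.op (show d.unop ⟶ c from a)) (f.hom.app _ (𝟙 c)) := by
    have := ConcreteCategory.congr_hom (f.hom.naturality (Quiver.Hom.op (show d.unop ⟶ c from a)))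
      (𝟙 c)
    refine Eq.trans ?_ this
    change _ = f.hom.app d ((show d.unop ⟶ c from a) ≫ 𝟙 c)
    rw [Category.comp_id]
  rw [key f, key g, h]

lemma LinearPresheaf.ofElement_comp {F G : LinearPresheaf k C} {c : C}
    (x : F.obj.obj (Opposite.op c)) (f : F ⟶ G) :
    ofElement x ≫ f = ofElement (f.hom.app _ x) := by
  apply hom_yoneda_ext
  rw [ofElement_app_id]
  change f.hom.app _ ((ofElement x).hom.app _ (𝟙 c)) = _
  rw [ofElement_app_id]

end

/-! ### Left exactness as a locality condition, and the reflector. -/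

section
open Opposite

lemma preservesKernel_op_iff {k : Type u} [CommRing k] {C : Type u} [SmallCategory C]
    [Preadditive C] [HasFiniteColimits C] (F : Cᵒᵖ ⥤ ModuleCat.{u} k) [F.Additive] {a b : C} (f : a ⟶ b) :
    PreservesLimit (parallelPair f.op 0) F ↔
      Function.Injective (F.map (cokernel.π f).op) ∧
        ∀ x : F.obj (op b), F.map f.op x = 0 → ∃ z, F.map (cokernel.π f).op z = x := by
  have w : (cokernel.π f).op ≫ f.op = 0 := by rw [← op_comp, cokernel.condition, op_zero]
  let S : ShortComplex Cᵒᵖ := .mk _ _ w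
  have hS : IsLimit (KernelFork.ofι S.f S.zero) :=
    CokernelCofork.IsColimit.ofπOp _ (cokernel.condition f) (cokernelIsCokernel f)
  trans Nonempty (IsLimit (KernelFork.ofι (S.map F).f (S.map F).zero))
  · refine ⟨fun h => ⟨KernelFork.mapIsLimit _ hS F⟩, fun ⟨h⟩ =>
      preservesLimit_of_preserves_limit_cone hS
        ((KernelFork.isLimitMapConeEquiv _ F).symm (IsLimit.ofIsoLimit h (Fork.ext (Iso.refl _))))⟩
  · rw [← ShortComplex.exact_and_mono_f_iff_f_is_kernel, and_comm, ModuleCat.mono_iff_injective,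
      ShortComplex.moduleCat_exact_iff]
    rfl

variable {k : Type u} [CommRing k] {C : Type u} [SmallCategory C] [Preadditive C] [Linear k C]

namespace LinearPresheaf

lemma ofElement_injective {F : LinearPresheaf k C} {c : C} :
    Function.Injective (ofElement : F.obj.obj (op c) → (_ ⟶ F)) := fun x y h => by
  rw [← ofElement_app_id x, h, ofElement_app_id]

lemma ofElement_surjective {F : LinearPresheaf k C} {c : C} :
    Function.Surjective (ofElement : F.obj.obj (op c) → (_ ⟶ F)) := fun f =>
  ⟨f.hom.app _ (𝟙 c), hom_yoneda_ext (ofElement_app_id _)⟩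

variable (k C) in
/-- The `k`-linear Yoneda embedding, with values in `k`-linear presheaves. -/
abbrev yonedaObj (c : C) : LinearPresheaf k C := (lexInclusion k C).obj (lexYoneda k C c)

variable (k) in
/-- The morphism of representable presheaves induced by a morphism of `C`. -/
def yonedaMap {c d : C} (f : c ⟶ d) : yonedaObj k C c ⟶ yonedaObj k C d :=
  ofElement (F := yonedaObj k C d) (c := c) f

lemma yonedaMap_comp_ofElement {c d : C} (f : c ⟶ d) {F : LinearPresheaf k C}
    (x : F.obj.obj (op d)) :
    yonedaMap k f ≫ ofElement x = ofElement (F.obj.map f.op x) := by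
  exact ofElement_comp (F := yonedaObj k C d) (c := c) f (ofElement x)

lemma ofElement_zero {F : LinearPresheaf k C} {c : C} :
    ofElement (0 : F.obj.obj (op c)) = 0 :=
  hom_yoneda_ext (ofElement_app_id _)

lemma ofElement_eq_zero_iff {F : LinearPresheaf k C} {c : C} {x : F.obj.obj (op c)} :
    ofElement x = 0 ↔ x = 0 := by
  rw [← ofElement_zero, ofElement_injective.eq_iff]

lemma yonedaMap_comp {c d e : C} (f : c ⟶ d) (g : d ⟶ e) :
    yonedaMap k f ≫ yonedaMap k g = yonedaMap k (f ≫ g) :=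
  yonedaMap_comp_ofElement _ _

lemma yonedaMap_zero {c d : C} : yonedaMap k (0 : c ⟶ d) = 0 :=
  ofElement_zero (F := yonedaObj k C d)

variable (k) [HasFiniteColimits C]

/-- The comparison from the cokernel of representables to the presheaf represented by
the cokernel. -/
noncomputable def cokernelComparison {a b : C} (f : a ⟶ b) :
    cokernel (yonedaMap k f) ⟶ yonedaObj k C (cokernel f) :=
  cokernel.desc _ (yonedaMap k (cokernel.π f))
    (by rw [yonedaMap_comp, cokernel.condition, yonedaMap_zero])

variable (C) in
/-- The comparison morphisms of cokernels of representables. -/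
def cokernelComparisons : MorphismProperty (LinearPresheaf k C) :=
  .ofHoms fun i : Σ a b : C, a ⟶ b => cokernelComparison k i.2.2

variable {k}

/-- By Yoneda, maps from the cokernel of `yonedaMap k f` to `F` are the elements killed by
`F.obj.map f.op`, so precomposition is the canonical map from `F (cokernel f)` to that kernel. -/
lemma bijective_cokernelComparison_comp_iff (F : LinearPresheaf k C) {a b : C} (f : a ⟶ b) :
    Function.Bijective (fun g : _ ⟶ F => cokernelComparison k f ≫ g) ↔
      Function.Injective (F.obj.map (cokernel.π f).op) ∧
        ∀ x : F.obj.obj (op b), F.obj.map f.op x = 0 → ∃ z, F.obj.map (cokernel.π f).op z = x := by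
  have hπ (z : F.obj.obj (op (cokernel f))) :
      cokernel.π _ ≫ cokernelComparison k f ≫ ofElement z =
        ofElement (F.obj.map (cokernel.π f).op z) := by
    rw [cokernelComparison, cokernel.π_desc_assoc, yonedaMap_comp_ofElement]
  refine and_congr ⟨fun h x y e => ?_, fun h g g' e => ?_⟩ ⟨fun h x hx => ?_, fun h g => ?_⟩
  · apply ofElement_injective
    apply h
    simp only [← cancel_epi (cokernel.π (yonedaMap k f)), hπ, e]
  · obtain ⟨x, rfl⟩ := ofElement_surjective g
    obtain ⟨y, rfl⟩ := ofElement_surjective g'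
    simp only [← cancel_epi (cokernel.π (yonedaMap k f)), hπ] at e
    rw [h (ofElement_injective e)]
  · obtain ⟨g, hg⟩ := h (cokernel.desc _ (ofElement x)
      (by rw [yonedaMap_comp_ofElement, hx, ofElement_zero]))
    obtain ⟨z, rfl⟩ := ofElement_surjective g
    refine ⟨z, ofElement_injective ?_⟩
    rw [← hπ]
    dsimp only at hg
    rw [hg, cokernel.π_desc]
  · obtain ⟨x, hx⟩ := ofElement_surjective (cokernel.π _ ≫ g)
    obtain ⟨z, hz⟩ := h x (by
      rw [← ofElement_eq_zero_iff, ← yonedaMap_comp_ofElement, hx, cokernel.condition_assoc,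
        zero_comp])
    exact ⟨ofElement z, by simp only [← cancel_epi (cokernel.π (yonedaMap k f)), hπ, hz, hx]⟩

lemma isLocal_cokernelComparisons_iff (F : LinearPresheaf k C) :
    (cokernelComparisons k C).isLocal F ↔ PreservesFiniteLimits F.obj := by
  have := F.property.1
  trans ∀ ⦃a b : C⦄ (f : a ⟶ b), PreservesLimit (parallelPair f.op 0) F.obj
  · have key {a b : C} (f : a ⟶ b) := (bijective_cokernelComparison_comp_iff F f).trans
      (preservesKernel_op_iff F.obj f).symm
    refine ⟨fun h a b f => (key f).1 (h _ (.mk (⟨a, b, f⟩ : Σ a b : C, a ⟶ b))), fun h X Y f hf => ?_⟩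
    obtain ⟨i⟩ := hf
    exact (key i.2.2).2 (h i.2.2)
  -- An additive functor preserving kernels preserves all finite limits.
  · refine ⟨fun h => ?_, fun h => inferInstance⟩
    have := hasZeroObject_of_hasInitial_object (C := C)
    have := HasBinaryBiproducts.of_hasBinaryCoproducts (C := C)
    have (X Y : Cᵒᵖ) (f : X ⟶ Y) : PreservesLimit (parallelPair f 0) F.obj := h f.unop
    exact Functor.preservesFiniteLimits_of_preservesKernels _

variable (k C) in
/-- Evaluation of linear presheaves at an object, with values in types. -/
abbrev evaluationType (c : C) : LinearPresheaf k C ⥤ Type u :=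
  (IsLinearPresheaf k C).ι ⋙ (evaluation _ _).obj (op c) ⋙ forget _

variable (k) in
/-- The Yoneda lemma, as an isomorphism of functors. -/
noncomputable def evaluationTypeIso (c : C) : evaluationType k C c ≅ coyoneda.obj (op (yonedaObj k C c)) :=
  NatIso.ofComponents
    (fun F => (Equiv.ofBijective _ ⟨ofElement_injective (F := F), ofElement_surjective⟩).toIso)
    fun f => by ext x; exact (ofElement_comp _ _).symm

open Cardinal in
lemma isRightAdjoint_lexInclusion : (lexInclusion k C).IsRightAdjoint := by
  have := fact_isRegular_aleph0
  have hy (c : C) : IsCardinalPresentable (yonedaObj k C c) (ℵ₀ : Cardinal.{u}) := by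
    rw [← IsFinitelyPresentable, isFinitelyPresentable_iff_preservesFilteredColimits]
    exact ⟨fun J _ _ => preservesColimitsOfShape_of_natIso (evaluationTypeIso k c)⟩
  have : (cokernelComparisons k C).isLocal.ι.IsRightAdjoint := by
    have : MorphismProperty.IsSmall.{u} (cokernelComparisons k C) := by
      rw [cokernelComparisons]; infer_instance
    refine MorphismProperty.isRightAdjoint_ι_isLocal _ (ℵ₀ : Cardinal.{u}) ?_
    rintro _ _ _ ⟨⟨a, b, f⟩⟩
    refine ⟨?_, hy _⟩
    have (j : WalkingParallelPair) : IsCardinalPresentable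
        ((parallelPair (yonedaMap k f) 0).obj j) (ℵ₀ : Cardinal.{u}) := by
      cases j <;> exact hy _
    -- A finite colimit of finitely presentable objects is finitely presentable.
    refine isCardinalPresentable_of_isColimit _ (cokernelIsCokernel (yonedaMap k f)) _ ?_
    exact hasCardinalLT_of_finite _ _ le_rfl
  let T := (cokernelComparisons k C).isLocal.lift (lexInclusion k C)
    fun F => (isLocal_cokernelComparisons_iff _).2 F.property.2
  have : T.EssSurj := ⟨fun G => ⟨⟨G.obj.obj, G.obj.property,
    (isLocal_cokernelComparisons_iff _).1 G.property⟩, ⟨Iso.refl _⟩⟩⟩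
  have : T.IsEquivalence := { }
  exact inferInstanceAs (T ⋙ (cokernelComparisons k C).isLocal.ι).IsRightAdjoint

end LinearPresheaf

end

/-! ### Monomorphisms under reflectors and right exact functors. -/

section
variable {P E : Type*} [Category* P] [Category* E] [Abelian P] [Abelian E]
  {L : P ⥤ E} {i : E ⥤ P} (adj : L ⊣ i)

include adj in
/-- If a morphism in a reflective abelian subcategory of an abelian category factors in the ambient
category as an epimorphism followed by a monomorphism, then the reflector sends the latter to
a monomorphism. -/
lemma mono_map_of_epi_mono_factorisation [i.Full] [i.Faithful] {A B : E} (u : A ⟶ B) {I : P}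
    (e : i.obj A ⟶ I) (m : I ⟶ i.obj B) [Epi e] [Mono m] (fac : e ≫ m = i.map u) :
    Mono (L.map m) := by
  have := adj.isLeftAdjoint
  have := adj.isRightAdjoint
  have he : i.map (kernel.ι u) ≫ e = 0 := by
    rw [← cancel_mono m, Category.assoc, fac, ← i.map_comp, kernel.condition, i.map_zero, zero_comp]
  refine Preadditive.mono_of_cancel_zero _ fun {T} g hg => ?_
  -- After refinement `g` lifts to `y` through the epimorphism `L.map e`. Up to the counit `y` is
  -- killed by `u`, so it comes from `kernel u`, which `e` annihilates.
  obtain ⟨T', π, _, y, hy⟩ := surjective_up_to_refinements_of_epi (L.map e) g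
  have hyu : (y ≫ adj.counit.app A) ≫ u = 0 := by
    rw [Category.assoc, ← Functor.id_map u, ← adj.counit.naturality, Functor.comp_map, ← fac,
      L.map_comp, Category.assoc, ← reassoc_of% hy, reassoc_of% hg, zero_comp, comp_zero]
  have hy' : y = kernel.lift u _ hyu ≫ inv (adj.counit.app _) ≫ L.map (i.map (kernel.ι u)) := by
    rw [← cancel_mono (adj.counit.app A)]
    simp
  rw [← cancel_epi π, hy, hy', Category.assoc, Category.assoc, ← L.map_comp, he, L.map_zero,
    comp_zero, comp_zero, comp_zero]

/-- A right exact functor preserves a monomorphism `F ⟶ G` if it preserves all monomorphisms into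
some object of which `G` is a quotient. -/
lemma mono_map_of_epi [PreservesFiniteColimits L] {Y F G : P} (p : Y ⟶ G) [Epi p]
    (hY : ∀ ⦃S : P⦄ (n : S ⟶ Y) [Mono n], Mono (L.map n)) (m : F ⟶ G) [Mono m] :
    Mono (L.map m) := by
  have : L.PreservesZeroMorphisms := inferInstance
  let p' := pullback.snd p m
  let m' := pullback.fst p m
  have := hY m'
  have := hY (kernel.ι p)
  refine Preadditive.mono_of_cancel_zero _ fun {T} g hg => ?_
  -- The lift `y` to the pullback becomes zero in `L.obj G`, so by right exactness it comes from
  -- `kernel p`. That kernel also embeds in the pullback, where `p'` kills it.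
  obtain ⟨T', π, _, y, hy⟩ := surjective_up_to_refinements_of_epi (L.map p') g
  have hyp : (y ≫ L.map m') ≫ L.map p = 0 := by
    rw [Category.assoc, ← L.map_comp, pullback.condition, L.map_comp, ← Category.assoc, ← hy,
      Category.assoc, hg, comp_zero]
  have hex : (ShortComplex.mk (L.map (kernel.ι p)) (L.map p)
      (by rw [← L.map_comp, kernel.condition, L.map_zero])).Exact :=
    ShortComplex.exact_of_g_is_cokernel _ (CokernelCofork.mapIsColimit _
      (Abelian.epiIsCokernelOfKernel _ (kernelIsKernel p)) L)
  obtain ⟨z, hz⟩ : ∃ z : T' ⟶ L.obj (kernel p), z ≫ L.map (kernel.ι p) = y ≫ L.map m' :=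
    ⟨hex.lift _ hyp, hex.lift_f _ _⟩
  let n : kernel p ⟶ pullback p m := pullback.lift (kernel.ι p) 0 (by simp)
  have hn : n ≫ m' = kernel.ι p := pullback.lift_fst _ _ _
  have hn' : n ≫ p' = 0 := pullback.lift_snd _ _ _
  have hyz : y = z ≫ L.map n := by
    rw [← cancel_mono (L.map m'), ← hz, Category.assoc, ← L.map_comp n, hn]
  rw [← cancel_epi π, hy, hyz, Category.assoc, ← L.map_comp n, hn', L.map_zero, comp_zero, comp_zero]

/-- A right exact functor between abelian categories which preserves monomorphisms is left exact. -/
lemma preservesFiniteLimits_of_mono_map [PreservesFiniteColimits L]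
    (h : ∀ ⦃F G : P⦄ (m : F ⟶ G) [Mono m], Mono (L.map m)) : PreservesFiniteLimits L := by
  have := preservesBinaryBiproducts_of_preservesBinaryCoproducts L
  have := L.additive_of_preservesBinaryBiproducts
  rw [L.preservesFiniteLimits_iff_forall_exact_map_and_mono]
  intro S hS
  have := hS.mono_f
  exact ⟨(L.preservesFiniteColimits_iff_forall_exact_map_and_epi.1 inferInstance S hS).1, h S.f⟩

end

/-! ### A presheaf as the directed union of its cyclic subpresheaves. -/

section
open Opposite
variable {k : Type u} [CommRing k] {C : Type u} [SmallCategory C] [Preadditive C] [Linear k C]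

namespace LinearPresheaf

/-- The elements of a linear presheaf. -/
structure Element (F : LinearPresheaf k C) : Type u where
  /-- The object at which the element lives. -/
  base : C
  /-- The element of the value of the presheaf. -/
  val : F.obj.obj (op base)

namespace Element

variable {F : LinearPresheaf k C}

/-- A preorder suffices in place of the category of elements: inclusions between subobjects are
unique. -/
instance : Preorder F.Element where
  le x y := ∃ f : x.base ⟶ y.base, F.obj.map f.op y.val = x.val
  le_refl x := ⟨𝟙 _, by simp⟩
  le_trans x y z := by
    rintro ⟨f, hf⟩ ⟨g, hg⟩
    exact ⟨f ≫ g, by rw [← hf, ← hg]; simp⟩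

instance [HasFiniteColimits C] : Nonempty F.Element := ⟨⟨⊥_ C, 0⟩⟩

instance [HasFiniteColimits C] : IsDirectedOrder F.Element where
  directed x y := by
    have := HasBinaryBiproducts.of_hasBinaryCoproducts (C := C)
    have := F.property.1
    refine ⟨⟨x.base ⊞ y.base,
      F.obj.map biprod.fst.op x.val + F.obj.map biprod.snd.op y.val⟩,
      ⟨biprod.inl, ?_⟩, ⟨biprod.inr, ?_⟩⟩
    all_goals
      simp only [map_add, ← ConcreteCategory.comp_apply, ← Functor.map_comp, ← op_comp]
      simp

variable (F) in
/-- The image of the morphism out of a representable presheaf determined by an element. -/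
noncomputable abbrev span (x : F.Element) : LinearPresheaf k C := image (ofElement x.val)

lemma exists_comp_ι {x y : F.Element} (h : x ≤ y) :
    ∃ g : x.span F ⟶ y.span F, g ≫ image.ι (ofElement y.val) = image.ι (ofElement x.val) := by
  obtain ⟨f, hf⟩ := h
  exact ⟨image.lift
    { I := y.span F
      m := image.ι _
      e := yonedaMap k f ≫ factorThruImage _
      fac := by rw [Category.assoc, image.fac, yonedaMap_comp_ofElement, hf] }, image.lift_fac _⟩

variable (F) in
/-- The diagram of the cyclic subpresheaves of a linear presheaf. -/
noncomputable def spanDiagram : F.Element ⥤ LinearPresheaf k C where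
  obj x := x.span F
  map f := (exists_comp_ι (leOfHom f)).choose
  map_id x := by
    rw [← cancel_mono (image.ι _), (exists_comp_ι (leOfHom (𝟙 x))).choose_spec, Category.id_comp]
  map_comp f g := by
    rw [← cancel_mono (image.ι _), (exists_comp_ι (leOfHom (f ≫ g))).choose_spec, Category.assoc,
      (exists_comp_ι (leOfHom g)).choose_spec, (exists_comp_ι (leOfHom f)).choose_spec]

lemma spanDiagram_map_ι {x y : F.Element} (f : x ⟶ y) :
    (spanDiagram F).map f ≫ image.ι (ofElement y.val) = image.ι (ofElement x.val) :=
  (exists_comp_ι (leOfHom f)).choose_spec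

lemma mono_spanDiagram_map {x y : F.Element} (f : x ⟶ y) : Mono ((spanDiagram F).map f) :=
  have : Mono ((spanDiagram F).map f ≫ image.ι (ofElement y.val)) := by
    rw [spanDiagram_map_ι]
    exact inferInstanceAs (Mono (image.ι (ofElement x.val)))
  mono_of_mono _ (image.ι (ofElement y.val))

variable (F) in
/-- A linear presheaf, as a cocone over its cyclic subpresheaves. -/
noncomputable def spanCocone : Cocone (spanDiagram F) where
  pt := F
  ι :=
    { app x := image.ι (ofElement x.val)
      naturality _ _ f := (spanDiagram_map_ι f).trans (Category.comp_id _).symm }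

variable (F) in
/-- A linear presheaf is the filtered colimit of its cyclic subpresheaves. -/
noncomputable def isColimitSpanCocone [HasFiniteColimits C] : IsColimit (spanCocone F) := by
  apply isColimitOfReflects (IsLinearPresheaf k C).ι
  refine evaluationJointlyReflectsColimits _ fun d => ?_
  apply isColimitOfReflects (forget (ModuleCat.{u} k))
  apply Types.FilteredColimit.isColimitOf'
  · intro t
    let x : F.Element := ⟨d.unop, t⟩
    refine ⟨x, (factorThruImage (ofElement x.val)).hom.app d (𝟙 d.unop), ?_⟩
    have := ConcreteCategory.congr_hom (congr_app (congr_arg (·.hom) (image.fac (ofElement x.val))) d)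
      (𝟙 d.unop)
    exact (ofElement_app_id (c := d.unop) t).symm.trans this.symm
  · intro x s t h
    have : Mono ((evaluationType k C d.unop).map (image.ι (ofElement x.val))) := inferInstance
    -- The cocone legs are injective, so no passage to a later stage is needed.
    exact ⟨x, 𝟙 x, by rw [(mono_iff_injective _).1 this h]⟩

end Element

/-! ### The reflector preserves monomorphisms when `Lex` is abelian. -/

section

lemma mono_of_evaluation_injective {F G : LexPresheaf k C} {f : F ⟶ G}
    (h : ∀ c, Function.Injective (f.hom.app (op c))) : Mono f := by
  have : Mono ((IsLexPresheaf k C).ι.map f) :=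
    (NatTrans.mono_iff_mono_app _).2 fun c => (ModuleCat.mono_iff_injective _).2 (h c.unop)
  exact (IsLexPresheaf k C).ι.mono_of_mono_map this

/-- The inclusion is a right adjoint, so it preserves monomorphisms. -/
lemma evaluation_injective_of_mono [HasFiniteColimits C] {F G : LexPresheaf k C}
    (f : F ⟶ G) [Mono f] (c : C) :
    Function.Injective (f.hom.app (op c)) := by
  have := (isRightAdjoint_lexInclusion (k := k) (C := C))
  have : Mono ((lexInclusion k C ⋙ evaluationType k C c).map f) := inferInstance
  exact (mono_iff_injective _).1 this

variable {L : LinearPresheaf k C ⥤ LexPresheaf k C} (adj : L ⊣ lexInclusion k C)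

include adj

lemma preservesFilteredColimits_evaluation (c : C) {J : Type u} [SmallCategory J] [IsFiltered J] :
    PreservesColimitsOfShape J (L ⋙ lexInclusion k C ⋙ evaluationType k C c) := by
  have := adj.leftAdjoint_preservesColimits
  have : PreservesColimitsOfShape J
      (lexInclusion k C ⋙ evaluationType k C c) :=
    inferInstanceAs (PreservesColimitsOfShape J
      ((IsLexPresheaf k C).ι ⋙ (evaluation _ _).obj (op c) ⋙ forget _))
  infer_instance

variable [HasFiniteColimits C]

/-- The reflection of a linear presheaf, evaluated at an object, is the filtered colimit of
the reflections of its cyclic subpresheaves. -/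
noncomputable def isColimitEvaluationSpanCocone (F : LinearPresheaf k C) (c : C) :
    IsColimit ((L ⋙ lexInclusion k C ⋙ evaluationType k C c).mapCocone (Element.spanCocone F)) :=
  have := preservesFilteredColimits_evaluation adj c (J := F.Element)
  isColimitOfPreserves _ (Element.isColimitSpanCocone F)

lemma mono_map_of_span {F G : LinearPresheaf k C} (m : F ⟶ G)
    (h : ∀ x : F.Element, Mono (L.map (image.ι (ofElement x.val) ≫ m))) : Mono (L.map m) := by
  refine mono_of_evaluation_injective fun c s t hst => ?_
  let Φ := L ⋙ lexInclusion k C ⋙ evaluationType k C c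
  obtain ⟨x, s, rfl⟩ := Types.jointly_surjective_of_isColimit
    (isColimitEvaluationSpanCocone adj F c) s
  obtain ⟨y, t, rfl⟩ := Types.jointly_surjective_of_isColimit
    (isColimitEvaluationSpanCocone adj F c) t
  obtain ⟨z, hxz, hyz⟩ := exists_ge_ge x y
  have hx := ConcreteCategory.congr_hom ((Φ.mapCocone (Element.spanCocone F)).w (homOfLE hxz)) s
  have hy := ConcreteCategory.congr_hom ((Φ.mapCocone (Element.spanCocone F)).w (homOfLE hyz)) t
  refine hx.symm.trans (Eq.trans ?_ hy)
  refine congr_arg ((Φ.mapCocone (Element.spanCocone F)).ι.app z) ?_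
  apply evaluation_injective_of_mono (L.map (image.ι (ofElement z.val) ≫ m)) c
  rw [L.map_comp]
  exact (congr_arg ((L.map m).hom.app (op c)) hx).trans
    (hst.trans (congr_arg ((L.map m).hom.app (op c)) hy).symm)

variable [Abelian (LexPresheaf k C)]

lemma mono_map_to_yonedaObj {F : LinearPresheaf k C} {c : C} (m : F ⟶ yonedaObj k C c) [Mono m] :
    Mono (L.map m) := by
  refine mono_map_of_span adj m fun x => ?_
  -- The composite runs between two representables, so it is a morphism of `Lex`.
  refine mono_map_of_epi_mono_factorisation adj
    ((lexInclusion k C).preimage (ofElement x.val ≫ m)) (factorThruImage (ofElement x.val)) _ ?_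
  rw [Functor.map_preimage, image.fac_assoc]

lemma mono_map_spanDiagram {F : LinearPresheaf k C} {x y : F.Element} (f : x ⟶ y) :
    Mono (L.map ((Element.spanDiagram F).map f)) := by
  have := adj.leftAdjoint_preservesColimits
  let m : x.span F ⟶ y.span F := (Element.spanDiagram F).map f
  have : Mono m := Element.mono_spanDiagram_map f
  exact mono_map_of_epi (factorThruImage (ofElement y.val))
    (fun S n _ => mono_map_to_yonedaObj adj n) m

/-- In a filtered colimit with injective transition maps the legs are injective. -/
lemma mono_map_span {F : LinearPresheaf k C} (x : F.Element) :
    Mono (L.map (image.ι (ofElement x.val))) := by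
  refine mono_of_evaluation_injective fun c s t hst => ?_
  obtain ⟨y, f, hf⟩ := (Types.FilteredColimit.isColimit_eq_iff'
    (isColimitEvaluationSpanCocone adj F c) s t).1 hst
  have := mono_map_spanDiagram adj f
  exact evaluation_injective_of_mono (L.map ((Element.spanDiagram F).map f)) c hf

lemma mono_map {F G : LinearPresheaf k C} (m : F ⟶ G) [Mono m] : Mono (L.map m) := by
  refine mono_map_of_span adj m fun x => ?_
  let y : G.Element := ⟨x.base, m.hom.app _ x.val⟩
  have fac : factorThruImage (ofElement x.val) ≫ image.ι (ofElement x.val) ≫ m =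
      ofElement y.val := by rw [image.fac_assoc, ofElement_comp]
  have := strongEpi_of_epi (factorThruImage (ofElement x.val))
  -- By uniqueness of images, a cyclic subpresheaf of `F` is identified with the one its image
  -- element spans in `G`.
  rw [← image.isoStrongEpiMono_hom_comp_ι _ _ fac, L.map_comp]
  have := mono_map_span adj y
  infer_instance

lemma preservesFiniteLimits_of_abelian : PreservesFiniteLimits L := by
  have := adj.leftAdjoint_preservesColimits
  exact preservesFiniteLimits_of_mono_map fun _ _ m _ => mono_map adj m

end

end LinearPresheaf

end

theorem lemmal (k : Type u) [CommRing k] (C : Type u) [SmallCategory C] [Preadditive C]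
    [Linear k C] [HasFiniteColimits C] :
    (lexInclusion k C).IsRightAdjoint ∧
      ∀ (L : LinearPresheaf k C ⥤ LexPresheaf k C), (L ⊣ lexInclusion k C) →
        (Nonempty (Abelian (LexPresheaf k C)) ↔ PreservesFiniteLimits L) := by
  refine ⟨LinearPresheaf.isRightAdjoint_lexInclusion, fun L adj => ⟨fun ⟨h⟩ => ?_, fun _ => ?_⟩⟩
  · exact LinearPresheaf.preservesFiniteLimits_of_abelian adj
  · let : Reflective (lexInclusion k C) := ⟨L, adj⟩
    have : HasFiniteProducts (LexPresheaf k C) :=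
      ⟨fun n => hasLimitsOfShape_of_reflective (lexInclusion k C)⟩
    have := adj.isLeftAdjoint
    have := hasZeroObject_of_hasTerminal_object (C := LexPresheaf k C)
    -- `L` preserves kernels by hypothesis and cokernels as a left adjoint, so it carries the
    -- coimage-image isomorphism over to `Lex`.
    exact ⟨abelianOfAdjunction (lexInclusion k C) L (asIso adj.counit) adj⟩
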